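/- Let $\mathbb{E}$ be a field of characteristic zero, let $X$ be a separated, integral scheme of finite type over $\mathbb{E}$ of dimension $l$ with function field $\mathbb{E}(X)$, and let $m \ge 0$ be an integer. Let $$\Omega_{X,rat}^m := (\Omega_{\mathbb{E}(X) \mid \mathbb{E}}^{\wedge l})^{\otimes m}$$ be the space of rational $m$-forms (powers over $\mathbb{E}(X)$), regarded as a constant sheaf on $X$. Let $\Omega_{X,reg}^m \subseteq \Omega_{X,rat}^m$ be the subsheaf of regular forms, i.e. the image of the natural map $(\Omega_{X \mid \mathbb{E}}^{\wedge l})^{\otimes m} \to \Omega_{X,rat}^m$. A formal prime divisor $\varphi$ on $X$ is given by a discrete valuation ring $A$ of $\mathbb{E}(X)$ containing $\mathbb{E}$, whose residue field has transcendence degree $l-1$ over $\mathbb{E}$, such that the canonical morphism $\operatorname{Spec} Q(\widehat{A}) \to \operatorname{Spec} \mathbb{E}(X) \to X$ extends to a morphism $\varphi : \operatorname{Spec} \widehat{A} \to X$; here $\widehat{A}$ is the completion of $A$ at its maximal ideal and $Q(\widehat{A})$ is its field of fractions. The center of $\varphi$ is the image of the closed point. A form $\eta \in \Omega_{X,rat}^m$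 is regular at $\varphi$ if its image under the map $$\varphi^\# : \Omega_{X,rat}^m \to Q(\widehat{A}) \otimes_A (\Omega_{A \mid \mathbb{E}}^{\wedge l})^{\otimes m}$$ induced by $\mathbb{E}(X) \hookrightarrow Q(\widehat{A})$ lies in $\widehat{A} \otimes_A (\Omega_{A \mid \mathbb{E}}^{\wedge l})^{\otimes m}$. The sheaf $\Omega_{X,adj}^m \subseteq \Omega_{X,rat}^m$ of $m$-adjoint forms assigns to an open set $U \subseteq X$ the set of all $\eta \in \Omega_{X,rat}^m$ that are regular at all formal prime divisors on $X$ with center in $U$. If $p \in X$ is a regular point (i.e. the local ring $\mathcal{O}_{X,p}$ is regular), then the stalks $$(\Omega_{X,reg}^m)_p = (\Omega_{X,adj}^m)_p$$ are equal as subsets of $\Omega_{X,rat}^m$. -/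

import Mathlib

open AlgebraicGeometry CategoryTheory IsLocalRing
open scoped TensorProduct KaehlerDifferential

universe u

noncomputable section

namespace AdjointForms

/-! ### Tensor powers of exterior powers and their functoriality -/

/-- `(⋀^l M)^{⊗ m}`, for a module `M` over a commutative ring `R`. -/
abbrev Pluri (R : Type*) [CommRing R] (M : Type*) [AddCommGroup M] [Module R M] (l m : ℕ) :=
  ⨂[R]^m (⋀[R]^l M)

section Functoriality

variable {R : Type*} [CommRing R] (S : Type*) [CommRing S] [Algebra R S]
  {M N : Type*} [AddCommGroup M] [Module R M] [AddCommGroup N] [Module S N] [Module R N]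
  [IsScalarTower R S N]

/-- The map `⋀_R^l M → ⋀_S^l N`, `x₁ ∧ ⋯ ∧ x_l ↦ f x₁ ∧ ⋯ ∧ f x_l`, induced by an `R`-linear map
`f` from an `R`-module `M` to an `S`-module `N`. -/
def exteriorMap (f : M →ₗ[R] N) (l : ℕ) : ⋀[R]^l M →ₗ[R] ⋀[S]^l N :=
  exteriorPower.alternatingMapLinearEquiv
    { ((exteriorPower.ιMulti S l (M := N)).toMultilinearMap.restrictScalars R).compLinearMap
        (fun _ => f) with
      map_eq_zero_of_eq' := fun v _ _ h hij =>
        (exteriorPower.ιMulti S l (M := N)).map_eq_zero_of_eq (fun k => f (v k))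
          (congrArg f h) hij }

/-- The map `(⋀_R^l M)^{⊗ m} → (⋀_S^l N)^{⊗ m}` induced by an `R`-linear map `f` from an
`R`-module `M` to an `S`-module `N`. -/
def pluriMap (f : M →ₗ[R] N) (l m : ℕ) : Pluri R M l m →ₗ[R] Pluri S N l m :=
  PiTensorProduct.lift
    (((PiTensorProduct.tprod S (s := fun _ : Fin m => ⋀[S]^l N)).restrictScalars R).compLinearMap
      fun _ => exteriorMap S f l)

end Functoriality

/-! ### Divisorial valuation rings and their completions -/

/-- Valuation rings of a field `K` (with field of fractions `K`) that contain the subfield `E`. -/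
structure ValuationRingOver (E K : Type u) [Field E] [Field K] [Algebra E K] where
  ring : ValuationSubring K
  algebraMap_mem : ∀ e : E, algebraMap E K e ∈ ring

namespace ValuationRingOver

variable {E K : Type u} [Field E] [Field K] [Algebra E K] (A : ValuationRingOver E K)

instance : Algebra E A.ring :=
  ((algebraMap E K).codRestrict A.ring.toSubring A.algebraMap_mem).toAlgebra

instance : IsScalarTower E A.ring K := IsScalarTower.of_algebraMap_eq fun _ => rfl

/-- The transcendence degree over `E` of the residue field of `A`. -/
def residueTrdeg : Cardinal.{u} := Algebra.trdeg E (ResidueField A.ring)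

end ValuationRingOver

/-- Divisorial valuation rings of `K` over `E`, where `l` is the transcendence degree of `K` over
`E`: the valuation is discrete of rank one and the residue field has transcendence degree `l - 1`
over `E`. -/
structure DivisorialValuationRing (E K : Type u) [Field E] [Field K] [Algebra E K] (l : ℕ) extends
    ValuationRingOver E K where
  isDiscreteValuationRing : IsDiscreteValuationRing ring
  residueTrdeg_add_one : toValuationRingOver.residueTrdeg + 1 = l

namespace DivisorialValuationRing

variable {E K : Type u} [Field E] [Field K] [Algebra E K] {l : ℕ}
  (A : DivisorialValuationRing E K l)

instance : IsDiscreteValuationRing A.ring := A.isDiscreteValuationRing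

/-- The completion `Â` of `A` with respect to its maximal ideal. -/
abbrev Completion : Type u := AdicCompletion (maximalIdeal A.ring) A.ring

/-- The field of fractions `Q(Â)`. -/
abbrev CompletionField : Type u := FractionRing A.Completion

lemma isUnit_algebraMap (a : nonZeroDivisors A.ring) :
    IsUnit (algebraMap A.ring A.CompletionField a) := by
  have h : IsSMulRegular A.Completion (a : A.ring) :=
    Module.Flat.isSMulRegular_of_nonZeroDivisors a.2
  have h' : algebraMap A.ring A.Completion a ∈ nonZeroDivisors A.Completion := by
    rw [mem_nonZeroDivisors_iff_right]
    intro x hx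
    apply h
    simpa [Algebra.smul_def, mul_comm] using hx
  rw [IsScalarTower.algebraMap_apply A.ring A.Completion A.CompletionField]
  exact IsLocalization.map_units (M := nonZeroDivisors A.Completion) A.CompletionField ⟨_, h'⟩

/-- The embedding `K = Q(A) → Q(Â)` that extends `A → Â`. -/
instance : Algebra K A.CompletionField :=
  (IsLocalization.lift (M := nonZeroDivisors A.ring) (S := K) A.isUnit_algebraMap).toAlgebra

instance : IsScalarTower A.ring K A.CompletionField :=
  IsScalarTower.of_algebraMap_eq fun a =>
    (IsLocalization.lift_eq (M := nonZeroDivisors A.ring) (S := K) A.isUnit_algebraMap a).symm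

instance : Algebra.FormallyEtale A.ring K :=
  Algebra.FormallyEtale.of_isLocalization (nonZeroDivisors A.ring)

/-- The universally finite module of differentials of `Â` over `E`. -/
abbrev Differentials : Type u := A.Completion ⊗[A.ring] Ω[A.ring⁄E]

/-- Its localization, a vector space over `Q(Â)`. -/
abbrev RatDifferentials : Type u := A.CompletionField ⊗[A.ring] Ω[A.ring⁄E]

/-- The canonical map from the differentials of `Â` to those of `Q(Â)`. -/
def differentialsToRat : A.Differentials →ₗ[A.Completion] A.RatDifferentials :=
  TensorProduct.AlgebraTensorModule.map (Algebra.linearMap A.Completion A.CompletionField)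
    LinearMap.id

/-- The `K`-linear map from the differentials of `K` to those of `Q(Â)` with `d a ↦ d a` for
all `a` in `A`. -/
def ratDifferentialMap : Ω[K⁄E] →ₗ[K] A.RatDifferentials :=
  TensorProduct.AlgebraTensorModule.map (Algebra.linearMap K A.CompletionField)
      (LinearMap.id : Ω[A.ring⁄E] →ₗ[A.ring] Ω[A.ring⁄E]) ∘ₗ
    (KaehlerDifferential.tensorKaehlerEquivOfFormallyEtale E A.ring K).symm.toLinearMap

end DivisorialValuationRing

/-! ### Rational differential forms on a scheme over a field -/

section Scheme

variable {E : Type u} [Field E] {X : Scheme.{u}} [X.Over (Spec (.of E))]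

instance (U : X.Opens) : Algebra E Γ(X, U) :=
  ((Scheme.ΓSpecIso (.of E)).inv ≫ (X ↘ Spec (.of E)).appTop ≫
    X.presheaf.map (homOfLE le_top).op).hom.toAlgebra

instance [IrreducibleSpace X] : Algebra E X.functionField :=
  ((Scheme.ΓSpecIso (.of E)).inv ≫ (X ↘ Spec (.of E)).appTop ≫
    X.presheaf.germ ⊤ (genericPoint X) trivial).hom.toAlgebra

instance [IrreducibleSpace X] (U : X.Opens) [Nonempty U] :
    IsScalarTower E Γ(X, U) X.functionField :=
  IsScalarTower.of_algebraMap_eq' <| by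
    have h : (Scheme.ΓSpecIso (.of E)).inv ≫ (X ↘ Spec (.of E)).appTop ≫
          X.presheaf.germ ⊤ (genericPoint X) trivial =
        ((Scheme.ΓSpecIso (.of E)).inv ≫ (X ↘ Spec (.of E)).appTop ≫
          X.presheaf.map (homOfLE le_top).op) ≫ X.germToFunctionField U := by
      simp only [Category.assoc, Scheme.germToFunctionField, TopCat.Presheaf.germ_res]
    exact congrArg CommRingCat.Hom.hom h

variable (E X) [IsIntegral X] (l m : ℕ)

/-- The rational forms `(Ω_{E(X)|E}^{∧ l})^{⊗ m}`. -/
abbrev RatForms : Type u := Pluri X.functionField Ω[X.functionField⁄E] l m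

/-- The natural map from `(Ω_{Γ(X,V)|E}^{∧ l})^{⊗ m}` to the rational forms. -/
def sectionToRat (V : X.Opens) [Nonempty V] :
    Pluri Γ(X, V) Ω[Γ(X, V)⁄E] l m →ₗ[Γ(X, V)] RatForms E X l m :=
  pluriMap X.functionField (KaehlerDifferential.map E E Γ(X, V) X.functionField) l m

/-- The sections over `U` of the sheaf of regular `m`-forms: the rational forms that, locally
on `U`, come from Kähler differentials of sections of the structure sheaf. -/
def regularForms (U : X.Opens) : Set (RatForms E X l m) :=
  {η | ∀ x ∈ U, ∃ (V : X.Opens) (_ : Nonempty V), x ∈ V ∧ V ≤ U ∧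
    η ∈ LinearMap.range (sectionToRat E X l m V)}

/-! ### Formal prime divisors and adjoint forms -/

/-- A formal prime divisor on `X`: a divisorial valuation ring `A` of `E(X)` over `E` such that
the canonical map `Spec Q(Â) ⟶ Spec E(X) ⟶ X` extends to a morphism `Spec Â ⟶ X`. -/
structure FormalPrimeDivisor where
  valuationRing : DivisorialValuationRing E X.functionField l
  hom : Spec (.of valuationRing.Completion) ⟶ X
  generic_comp_hom :
    Spec.map (CommRingCat.ofHom
        (algebraMap valuationRing.Completion valuationRing.CompletionField)) ≫ hom =
      Spec.map (CommRingCat.ofHom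
        (algebraMap X.functionField valuationRing.CompletionField)) ≫
          X.fromSpecStalk (genericPoint X)

namespace FormalPrimeDivisor

variable {E X l} (φ : FormalPrimeDivisor E X l)

/-- The center of `φ`: the image of the closed point. -/
def center : X := φ.hom (closedPoint φ.valuationRing.Completion)

/-- The forms of `Â`: the `m`-th tensor power of the `l`-th exterior power of its universally
finite module of differentials. It is canonically isomorphic to
`Â ⊗_A (Ω_{A|E}^{∧ l})^{⊗ m}`. -/
abbrev Forms : Type u :=
  Pluri φ.valuationRing.Completion φ.valuationRing.Differentials l m

/-- The forms of `Q(Â)`. Canonically isomorphic to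
`Q(Â) ⊗_A (Ω_{A|E}^{∧ l})^{⊗ m}`. -/
abbrev LaurentForms : Type u :=
  Pluri φ.valuationRing.CompletionField φ.valuationRing.RatDifferentials l m

/-- The canonical map from the forms of `Â` to the forms of `Q(Â)`. -/
def formsToLaurent : φ.Forms m →ₗ[φ.valuationRing.Completion] φ.LaurentForms m :=
  pluriMap φ.valuationRing.CompletionField φ.valuationRing.differentialsToRat l m

/-- The map `φ^#` from the rational forms on `X` to the forms of `Q(Â)`, `d f ↦ d φ^#(f)`. -/
def pullback : RatForms E X l m →ₗ[X.functionField] φ.LaurentForms m :=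
  pluriMap φ.valuationRing.CompletionField φ.valuationRing.ratDifferentialMap l m

/-- `η` is regular at `φ`. -/
def IsRegularAt {m : ℕ} (η : RatForms E X l m) : Prop :=
  φ.pullback m η ∈ LinearMap.range (φ.formsToLaurent m)

end FormalPrimeDivisor

/-- The sections over `U` of the sheaf of `m`-adjoint forms: the rational forms that are regular
at all formal prime divisors with center in `U`. -/
def adjointForms (U : X.Opens) : Set (RatForms E X l m) :=
  {η | ∀ φ : FormalPrimeDivisor E X l, φ.center ∈ U → φ.IsRegularAt η}

/-- The stalk at `p` of a subsheaf `F` of the constant sheaf `M`, as a subset of `M`. -/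
def stalk {X : Scheme.{u}} {M : Type*} (F : X.Opens → Set M) (p : X) : Set M :=
  {η | ∃ U : X.Opens, p ∈ U ∧ η ∈ F U}

end Scheme

end AdjointForms

end

/-! Write `K` for the function field and `R` for the local ring at `p`. Regular forms are adjoint on
every open set. If the center of `φ` lies in `V`, sections over `V` land in `Â` and in `K`, hence in
`Â ∩ K = A` (`mem_ring_of_algebraMap_eq`), so forms over `V` pull back through forms of `A`.

Conversely, regularity of `R` makes `Ω_R` free on differentials `dx₁, …, dx_l`, and any rational
form is `f • (dx₁ ∧ ⋯ ∧ dx_l)^{⊗ m}` with `f ∈ K`. If `f ∈ R`, the form is regular near `p`.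
Otherwise `f = a / b`, and `f` stays outside `R_P` for some associated prime `P` of `R / bR`. Such
an `R_P` is a discrete valuation ring. The reason used here is differential: free differentials in
characteristic zero supply enough derivations to exclude two independent cotangent vectors
(`isDiscreteValuationRing_of_free`). The ring `A = R_P` is divisorial, and its formal prime divisor
has a center specializing to `p`. Since the `dx_i` are also a basis of `Ω_A`, regularity of the form
there would force `f ∈ A`, a contradiction. -/

noncomputable section

namespace AdjointForms

/-! ### Functoriality of pluri-forms. -/

section Pluri

variable {R : Type*} [CommRing R] {S : Type*} [CommRing S] [Algebra R S]
  {T : Type*} [CommRing T] [Algebra R T] [Algebra S T] [IsScalarTower R S T]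
  {M N P : Type*} [AddCommGroup M] [Module R M] [AddCommGroup N] [Module S N] [Module R N]
  [IsScalarTower R S N] [AddCommGroup P] [Module T P] [Module S P] [Module R P]
  [IsScalarTower S T P] [IsScalarTower R T P]

/-- The form `(v₁ ∧ ⋯ ∧ v_l)^{⊗ m}`. -/
def wedgePow (R : Type*) [CommRing R] {M : Type*} [AddCommGroup M] [Module R M] {l : ℕ} (m : ℕ)
    (v : Fin l → M) : Pluri R M l m :=
  PiTensorProduct.tprod R fun _ => exteriorPower.ιMulti R l v

lemma exteriorMap_ιMulti (f : M →ₗ[R] N) {l : ℕ} (v : Fin l → M) :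
    exteriorMap S f l (exteriorPower.ιMulti R l v) = exteriorPower.ιMulti S l (f ∘ v) := by
  rw [exteriorMap, exteriorPower.alternatingMapLinearEquiv_apply_ιMulti]
  rfl

lemma pluriMap_tprod (f : M →ₗ[R] N) {l m : ℕ} (w : Fin m → ⋀[R]^l M) :
    pluriMap S f l m (PiTensorProduct.tprod R w) =
      PiTensorProduct.tprod S fun i => exteriorMap S f l (w i) := by
  rw [pluriMap, PiTensorProduct.lift.tprod]
  rfl

lemma pluriMap_wedgePow (f : M →ₗ[R] N) {l : ℕ} (m : ℕ) (v : Fin l → M) :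
    pluriMap S f l m (wedgePow R m v) = wedgePow S m (f ∘ v) := by
  simp only [wedgePow, pluriMap_tprod, exteriorMap_ιMulti]

lemma pluriMap_smul_wedgePow (f : M →ₗ[R] N) {l : ℕ} (m : ℕ) (r : R) (v : Fin l → M) :
    pluriMap S f l m (r • wedgePow R m v) = algebraMap R S r • wedgePow S m (f ∘ v) := by
  rw [map_smul, pluriMap_wedgePow, algebraMap_smul]

lemma exteriorMap_exteriorMap (f : M →ₗ[R] N) (g : N →ₗ[S] P) (h : M →ₗ[R] P)
    (hfg : ∀ x, g (f x) = h x) {l : ℕ} (x : ⋀[R]^l M) :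
    exteriorMap T g l (exteriorMap S f l x) = exteriorMap T h l x := by
  have hx : x ∈ Submodule.span R (Set.range (exteriorPower.ιMulti R l (M := M))) := by
    rw [exteriorPower.ιMulti_span]; trivial
  induction hx using Submodule.span_induction with
  | mem x hx =>
    obtain ⟨v, rfl⟩ := hx
    rw [exteriorMap_ιMulti, exteriorMap_ιMulti, exteriorMap_ιMulti]
    congr 1
    funext i
    exact hfg _
  | zero => simp
  | add x y _ _ hx hy => simp [hx, hy]
  | smul r x _ hx =>
    rw [map_smul (exteriorMap S f l), map_smul (exteriorMap T h l),
      ← algebraMap_smul S r (exteriorMap S f l x), map_smul, hx, algebraMap_smul]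

lemma pluriMap_pluriMap (f : M →ₗ[R] N) (g : N →ₗ[S] P) (h : M →ₗ[R] P)
    (hfg : ∀ x, g (f x) = h x) {l m : ℕ} (x : Pluri R M l m) :
    pluriMap T g l m (pluriMap S f l m x) = pluriMap T h l m x := by
  induction x using PiTensorProduct.induction_on with
  | smul_tprod r w =>
    rw [map_smul (pluriMap S f l m), map_smul (pluriMap T h l m),
      ← algebraMap_smul S r (pluriMap S f l m _), map_smul, pluriMap_tprod,
      pluriMap_tprod, pluriMap_tprod, algebraMap_smul]
    simp only [exteriorMap_exteriorMap f g h hfg]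
  | add x y hx hy => simp [hx, hy]

end Pluri

/-! ### Forms on a free module of rank `l`: free of rank one. -/

section Basis

variable {R : Type*} [CommRing R] {M : Type*} [AddCommGroup M] [Module R M] {l : ℕ}
  (b : Module.Basis (Fin l) R M)

/-- An alternating map in `l` variables is determined by its value on `b`, so the coefficient of `v₁
∧ ⋯ ∧ v_l` is `b.det v`. -/
lemma exists_eq_smul_ιMulti (x : ⋀[R]^l M) :
    ∃ r : R, x = r • exteriorPower.ιMulti R l b := by
  have hx : x ∈ Submodule.span R (Set.range (exteriorPower.ιMulti R l (M := M))) := by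
    rw [exteriorPower.ιMulti_span]; trivial
  induction hx using Submodule.span_induction with
  | mem x hx =>
    obtain ⟨v, rfl⟩ := hx
    refine ⟨b.det v, ?_⟩
    have : exteriorPower.ιMulti R l (M := M) =
        (LinearMap.toSpanSingleton R _ (exteriorPower.ιMulti R l b)).compAlternatingMap b.det := by
      refine Module.Basis.ext_alternating b fun σ hσ => ?_
      -- An injective self-map of `Fin l` is a permutation, and it changes both sides by its sign.
      obtain ⟨σ, rfl⟩ : ∃ τ : Equiv.Perm (Fin l), σ = τ :=
        ⟨Equiv.ofBijective σ (Finite.injective_iff_bijective.mp hσ), rfl⟩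
      have h := (exteriorPower.ιMulti R l (M := M)).map_perm b σ
      have h' := b.det.map_perm b σ
      simp only [Function.comp_def] at h h'
      simp [h, h', b.det_self]
    exact DFunLike.congr_fun this v
  | zero => exact ⟨0, by simp⟩
  | add x y _ _ hx hy =>
    obtain ⟨r, rfl⟩ := hx
    obtain ⟨s, rfl⟩ := hy
    exact ⟨r + s, (add_smul _ _ _).symm⟩
  | smul t x _ hx =>
    obtain ⟨r, rfl⟩ := hx
    exact ⟨t * r, (mul_smul _ _ _).symm⟩

lemma exists_eq_smul_wedgePow {m : ℕ} (x : Pluri R M l m) :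
    ∃ r : R, x = r • wedgePow R m b := by
  induction x using PiTensorProduct.induction_on with
  | smul_tprod r w =>
    choose s hs using fun i => exists_eq_smul_ιMulti b (w i)
    refine ⟨r * ∏ i, s i, ?_⟩
    rw [mul_smul, funext hs, MultilinearMap.map_smul_univ]
    rfl
  | add x y hx hy =>
    obtain ⟨r, rfl⟩ := hx
    obtain ⟨s, rfl⟩ := hy
    exact ⟨r + s, (add_smul _ _ _).symm⟩

/-- The determinant induces a functional `ε` with value 1 on the generator; for `m = 0` it is the
empty product. -/
lemma smul_wedgePow_injective (m : ℕ) :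
    Function.Injective fun r : R => r • wedgePow R m b := by
  let δ : ⋀[R]^l M →ₗ[R] R := exteriorPower.alternatingMapLinearEquiv b.det
  let ε : Pluri R M l m →ₗ[R] R :=
    PiTensorProduct.lift ((MultilinearMap.mkPiAlgebra R (Fin m) R).compLinearMap fun _ => δ)
  have h : ε (wedgePow R m b) = 1 := by
    simp [ε, δ, wedgePow, b.det_self]
  intro r s hrs
  simpa [h] using congrArg ε hrs

end Basis

/-! ### Transcendence degree and chains of primes. -/

section Trdeg

/-- A transcendence basis of `C` lifts to a polynomial subring of `B` meeting the kernel only in 0.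
A nonzero `b` in the kernel is transcendental over it: otherwise `b` would divide a nonzero
polynomial, which would then lie in the kernel. -/
lemma trdeg_add_one_le_of_surjective {E B C : Type u} [Field E] [CommRing B] [IsDomain B]
    [CommRing C] [IsDomain C] [Algebra E B] [Algebra E C] (f : B →ₐ[E] C)
    (hf : Function.Surjective f) (hf' : ¬ Function.Injective f) :
    Algebra.trdeg E C + 1 ≤ Algebra.trdeg E B := by
  obtain ⟨s, hs⟩ := exists_isTranscendenceBasis E C
  choose g hg using hf
  let φ : MvPolynomial s E →ₐ[E] B := MvPolynomial.aeval fun i => g i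
  have hφ : ∀ x, f (φ x) = MvPolynomial.aeval (Subtype.val : s → C) x := fun x => by
    rw [← AlgHom.comp_apply, MvPolynomial.comp_aeval]
    simp [hg]
  have hinj : Function.Injective fun x => f (φ x) := by
    simp only [hφ]
    exact hs.1
  let := φ.toRingHom.toAlgebra
  have : IsScalarTower E (MvPolynomial s E) B := IsScalarTower.of_algHom φ
  have : FaithfulSMul (MvPolynomial s E) B :=
    (faithfulSMul_iff_algebraMap_injective _ _).mpr fun x y hxy => hinj (congrArg f hxy)
  obtain ⟨b, hb, hb0⟩ : ∃ b, f b = 0 ∧ b ≠ 0 := by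
    simpa [injective_iff_map_eq_zero] using hf'
  have htr : Algebra.Transcendental (MvPolynomial s E) B := by
    refine ⟨b, fun halg => ?_⟩
    obtain ⟨r, hr, c, hc⟩ := halg.exists_nonzero_dvd (mem_nonZeroDivisors_of_ne_zero hb0)
    apply hr
    apply hinj
    change f (algebraMap _ B r) = f (φ 0)
    simp [hc, hb]
  calc Algebra.trdeg E C + 1 = Algebra.trdeg E (MvPolynomial s E) + 1 := by
        rw [MvPolynomial.trdeg_of_isDomain, ← hs.cardinalMk_eq_trdeg, Cardinal.lift_id]
    _ ≤ Algebra.trdeg E (MvPolynomial s E) + Algebra.trdeg (MvPolynomial s E) B := by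
        gcongr
        exact Cardinal.one_le_iff_pos.mpr (trdeg_pos _ _)
    _ ≤ Algebra.trdeg E B := trdeg_add_le

/-- Each strict inclusion in a chain of primes costs the quotient at least one transcendence degree,
and the last quotient still surjects onto the residue field. -/
lemma ringKrullDim_add_trdeg_residueField_le {E R : Type u} [Field E] [CommRing R] [IsDomain R]
    [IsLocalRing R] [Algebra E R] {l d : ℕ} (hl : Algebra.trdeg E R = l)
    (hd : d ≤ ringKrullDim R) :
    d + Algebra.trdeg E (ResidueField R) ≤ l := by
  obtain ⟨p, hp⟩ := Order.le_krullDim_iff.mp hd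
  have key : ∀ i (hi : i < p.length + 1),
      i + Algebra.trdeg E (R ⧸ (p ⟨i, hi⟩).asIdeal) ≤ Algebra.trdeg E R := by
    intro i
    induction i with
    | zero =>
      intro hi
      simpa using trdeg_le_of_surjective (Ideal.Quotient.mkₐ E (p ⟨0, hi⟩).asIdeal)
        Ideal.Quotient.mk_surjective
    | succ i ih =>
      intro hi
      have hlt : p ⟨i, by omega⟩ < p ⟨i + 1, hi⟩ := p.strictMono (by simp)
      refine le_trans ?_ (ih (by omega))
      rw [Nat.cast_add, add_assoc, Nat.cast_one, add_comm 1]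
      gcongr
      refine trdeg_add_one_le_of_surjective (Ideal.Quotient.factorₐ E hlt.le)
        (Ideal.Quotient.factor_surjective hlt.le) fun hinj => hlt.not_ge ?_
      intro x hx
      rw [← Ideal.Quotient.eq_zero_iff_mem] at hx ⊢
      apply hinj
      rw [map_zero]
      exact hx
  subst hp
  refine le_trans ?_ ((key p.length (by omega)).trans hl.le)
  gcongr
  have hle := le_maximalIdeal (p ⟨p.length, by omega⟩).2.ne_top
  exact trdeg_le_of_surjective (Ideal.Quotient.factorₐ E hle)
    (Ideal.Quotient.factor_surjective hle)

end Trdeg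

/-! ### Rank and freeness of Kähler differentials. -/

section Kaehler

/-- In characteristic zero `K` is separable algebraic over `E(s)` for a transcendence basis `s`.
Hence `E[s] → E(s) → K` is formally étale, and the differentials of `s` form a basis. -/
lemma finrank_kaehlerDifferential_eq_trdeg {E K : Type u} [Field E] [CharZero E] [Field K]
    [Algebra E K] {l : ℕ} (hl : Algebra.trdeg E K = l) :
    Module.finrank K Ω[K⁄E] = l ∧ Module.Finite K Ω[K⁄E] := by
  obtain ⟨s, hs⟩ := exists_isTranscendenceBasis E K
  have hcard := hs.cardinalMk_eq_trdeg
  rw [hl] at hcard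
  have hfin : Finite s := Cardinal.lt_aleph0_iff_finite.mp (hcard ▸ Cardinal.natCast_lt_aleph0)
  have : Fintype s := Fintype.ofFinite s
  let P := MvPolynomial s E
  let F := FractionRing P
  let φ : P →ₐ[E] K := MvPolynomial.aeval (Subtype.val : s → K)
  have hφ : Function.Injective φ := hs.1
  let := φ.toRingHom.toAlgebra
  have : IsScalarTower E P K := IsScalarTower.of_algHom φ
  let : Algebra F K := (IsFractionRing.lift (K := F) (g := φ.toRingHom) hφ).toAlgebra
  have : IsScalarTower P F K := IsScalarTower.of_algebraMap_eq fun x =>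
    (IsFractionRing.lift_algebraMap (K := F) (g := φ.toRingHom) hφ x).symm
  have : Algebra.IsAlgebraic P K := by
    have := hs.isAlgebraic
    refine Algebra.IsAlgebraic.of_ringHom_of_comp_eq hs.1.aevalEquiv (RingHom.id K)
      hs.1.aevalEquiv.surjective Function.injective_id ?_
    exact RingHom.ext fun x => hs.1.algebraMap_aevalEquiv x
  have : Algebra.IsAlgebraic F K := (IsFractionRing.comap_isAlgebraic_iff (A := P)).mp this
  have : Algebra.FormallyEtale F K := Algebra.FormallyEtale.of_isSeparable F K
  have : Algebra.FormallyEtale P F := Algebra.FormallyEtale.of_isLocalization (nonZeroDivisors P)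
  have : Algebra.FormallyEtale P K := Algebra.FormallyEtale.comp P F K
  let b := ((KaehlerDifferential.mvPolynomialBasis E s).baseChange K).map
    (KaehlerDifferential.tensorKaehlerEquivOfFormallyEtale E P K)
  refine ⟨?_, Module.Finite.of_basis b⟩
  rw [Module.finrank_eq_card_basis b]
  simpa using hcard

/-- This is the dimension count in the conormal sequence `𝔪/𝔪² → κ ⊗ Ω_R → Ω_κ → 0`. -/
lemma finrank_residueField_tensor_kaehlerDifferential_le {E R : Type u} [Field E] [CommRing R]
    [IsLocalRing R] [IsNoetherianRing R] [Algebra E R] [Module.Finite R Ω[R⁄E]] :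
    Module.finrank (ResidueField R) (ResidueField R ⊗[R] Ω[R⁄E]) ≤
      (maximalIdeal R).spanFinrank +
        Module.finrank (ResidueField R) Ω[ResidueField R⁄E] := by
  let κ := ResidueField R
  let f : κ ⊗[R] Ω[R⁄E] →ₗ[κ] Ω[κ⁄E] := KaehlerDifferential.mapBaseChange E R κ
  have hsurj : Function.Surjective (algebraMap R κ) := IsLocalRing.residue_surjective
  have hfg : (maximalIdeal R).FG := IsNoetherian.noetherian _
  let s := (maximalIdeal R).generators
  have hs : s.Finite := Submodule.FG.finite_generators hfg
  let g : R → κ ⊗[R] Ω[R⁄E] := fun x => 1 ⊗ₜ KaehlerDifferential.D E R x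
  have hker : LinearMap.ker f ≤ Submodule.span κ (g '' s) := by
    intro x hx
    have hx' : x ∈ (KaehlerDifferential.kerCotangentToTensor E R κ).range := by
      rw [KaehlerDifferential.range_kerCotangentToTensor E R κ hsurj]
      exact hx
    obtain ⟨y, rfl⟩ := hx'
    obtain ⟨⟨y, hy'⟩, rfl⟩ := Ideal.toCotangent_surjective _ y
    rw [KaehlerDifferential.kerCotangentToTensor_toCotangent]
    change g y ∈ _
    clear hx
    have hy : y ∈ Submodule.span R s := by
      rw [(maximalIdeal R).span_generators, ← IsLocalRing.ker_residue]
      exact hy'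
    clear hy'
    have hsm : ∀ z ∈ Submodule.span R s, residue R z = 0 := fun z hz => by
      rwa [(maximalIdeal R).span_generators, ← IsLocalRing.ker_residue] at hz
    induction hy using Submodule.span_induction with
    | mem z hz => exact Submodule.subset_span ⟨z, hz, rfl⟩
    | zero => simp [g]
    | add z w _ _ hz hw =>
      have : g (z + w) = g z + g w := by simp [g, TensorProduct.tmul_add]
      exact this ▸ add_mem hz hw
    | smul a z hz' hz =>
      -- In `d(az) = a dz + z da` the second term dies because `z` vanishes in `κ`; thus `g` is
      -- linear on `𝔪`.
      have : g (a • z) = algebraMap R κ a • g z := by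
        have hz0 : algebraMap R κ z = 0 := hsm z hz'
        simp only [g, smul_eq_mul, Derivation.leibniz, TensorProduct.tmul_add,
          ← TensorProduct.smul_tmul, Algebra.smul_def, hz0, mul_one, TensorProduct.zero_tmul,
          add_zero]
        rw [TensorProduct.smul_tmul', smul_eq_mul, mul_one]
      exact this ▸ Submodule.smul_mem _ _ hz
  have h1 := LinearMap.finrank_range_add_finrank_ker f
  have h2 : LinearMap.range f = ⊤ := LinearMap.range_eq_top.mpr
    (KaehlerDifferential.mapBaseChange_surjective E R κ hsurj)
  rw [h2, finrank_top] at h1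
  have h3 : Module.finrank κ (LinearMap.ker f) ≤ (maximalIdeal R).spanFinrank := by
    have : Module.Finite κ (Submodule.span κ (g '' s)) :=
      Module.Finite.span_of_finite κ (hs.image g)
    calc _ ≤ Module.finrank κ (Submodule.span κ (g '' s)) := Submodule.finrank_mono hker
      _ ≤ (g '' s).ncard := by
        have := (hs.image g).fintype
        rw [Set.ncard_eq_toFinset_card']
        exact finrank_span_le_card _
      _ ≤ s.ncard := Set.ncard_image_le hs
      _ = _ := Submodule.FG.generators_ncard hfg
  change Module.finrank κ (κ ⊗[R] Ω[R⁄E]) ≤ _ + Module.finrank κ Ω[κ⁄E]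
  omega

/-- If the fibre of `Ω_R` at the closed point is not larger than at the generic point, then `Ω_R` is
free, on the differentials of elements of `R`. -/
lemma exists_basis_kaehlerDifferential {E R K : Type u} [Field E] [CommRing R] [IsDomain R]
    [IsLocalRing R] [Algebra E R] [Field K] [Algebra R K] [Algebra E K] [IsScalarTower E R K]
    [IsFractionRing R K] [Module.Finite R Ω[R⁄E]] {l : ℕ} (hl : Module.finrank K Ω[K⁄E] = l)
    (hle : Module.finrank (ResidueField R) (ResidueField R ⊗[R] Ω[R⁄E]) ≤ l) :
    ∃ (x : Fin l → R) (b : Module.Basis (Fin l) R Ω[R⁄E]),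
      ∀ i, b i = KaehlerDifferential.D E R (x i) := by
  let κ := ResidueField R
  let g : R → κ ⊗[R] Ω[R⁄E] := fun x => 1 ⊗ₜ KaehlerDifferential.D E R x
  have hg : Submodule.span κ (Set.range g) = ⊤ := by
    rw [eq_top_iff]
    rintro x -
    induction x with
    | zero => exact zero_mem _
    | add x y hx hy => exact add_mem hx hy
    | tmul c y =>
      have hy : y ∈ Submodule.span R (Set.range (KaehlerDifferential.D E R)) := by
        rw [KaehlerDifferential.span_range_derivation]; trivial
      induction hy using Submodule.span_induction with
      | mem y hy =>
        obtain ⟨y, rfl⟩ := hy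
        have : c ⊗ₜ[R] KaehlerDifferential.D E R y = c • g y := by
          rw [TensorProduct.smul_tmul', smul_eq_mul, mul_one]
        exact this ▸ Submodule.smul_mem _ _ (Submodule.subset_span ⟨y, rfl⟩)
      | zero => simp
      | add y z _ _ hy hz => rw [TensorProduct.tmul_add]; exact add_mem hy hz
      | smul r y _ hy =>
        rw [TensorProduct.tmul_smul, ← algebraMap_smul κ r]
        exact Submodule.smul_mem _ _ hy
  -- The basis of the fibre is chosen among the elements `1 ⊗ dx`, so that Nakayama's lemma gives
  -- generators of `Ω_R` that are exact differentials.
  obtain ⟨t, ht, hspan, hli⟩ := exists_linearIndependent κ (Set.range g)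
  rw [hg] at hspan
  let c : Module.Basis t κ (κ ⊗[R] Ω[R⁄E]) := Module.Basis.mk hli (by simpa using hspan.ge)
  have htfin : Finite t := Module.Finite.finite_basis c
  have : Fintype t := Fintype.ofFinite t
  choose y hy using fun i : t => ht i.2
  have htop : Submodule.span R (Set.range fun i => KaehlerDifferential.D E R (y i)) = ⊤ :=
    IsLocalRing.span_eq_top_of_tmul_eq_basis _ c fun i => by simpa [c, g] using hy i
  have hcard : Fintype.card t ≤ l := (Module.finrank_eq_card_basis c).symm.trans_le hle
  have htopK : Submodule.span K (Set.range fun i =>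
      KaehlerDifferential.map E E R K (KaehlerDifferential.D E R (y i))) = ⊤ := by
    have := span_eq_top_of_isLocalizedModule K (nonZeroDivisors R)
      (KaehlerDifferential.map E E R K) htop
    rwa [← Set.range_comp] at this
  -- At most `l` generators span an `l`-dimensional space over `K`. There are thus exactly `l`,
  -- independent over `K` and so over `R`.
  have hcard' : Fintype.card t = l := by
    refine le_antisymm hcard ?_
    rw [← hl, ← finrank_top, ← htopK]
    exact finrank_range_le_card _
  have hliK := linearIndependent_of_top_le_span_of_card_eq_finrank htopK.ge (hcard'.trans hl.symm)
  have hliR : LinearIndependent R fun i => KaehlerDifferential.D E R (y i) :=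
    LinearIndependent.of_comp (KaehlerDifferential.map E E R K)
      (hliK.restrict_scalars (by
        simpa [Algebra.smul_def] using IsFractionRing.injective R K))
  let e : t ≃ Fin l := Fintype.equivFinOfCardEq hcard'
  exact ⟨y ∘ e.symm, (Module.Basis.mk hliR htop.ge).reindex e, fun i => by simp⟩

end Kaehler

/-! ### Derivations and a criterion for discrete valuation rings. -/

section Derivation

/-- If a derivation kills `x` and takes `y ∈ 𝔪` to a unit, then `y` is regular modulo `x`. -/
lemma dvd_of_dvd_mul_of_derivation {E S : Type*} [Field E] [CharZero E] [CommRing S]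
    [IsLocalRing S] [IsNoetherianRing S] [Algebra E S] (D : Derivation E S S) {x y a : S}
    (hx : D x = 0) (hy : IsUnit (D y)) (hym : y ∈ maximalIdeal S) (h : x ∣ y * a) : x ∣ a := by
  obtain ⟨u, hu⟩ := hy
  let D' : Derivation E S S := (↑u⁻¹ : S) • D
  have hx' : D' x = 0 := by simp [D', hx]
  have hy' : D' y = 1 := by simp [D', ← hu]
  have hstable : ∀ z, x ∣ z → x ∣ D' z := by
    rintro _ ⟨z, rfl⟩
    exact ⟨D' z, by simp [hx']⟩
  -- Modulo `x`, `D'` turns `y * a ≡ 0` into `y * D' a ≡ -a`. Iterating puts `n! * a`, hence `a`, in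
  -- `(x, yⁿ)` for every `n`; Krull's intersection theorem in `S / (x)` then gives `x ∣ a`.
  have key : ∀ n : ℕ, x ∣ y ^ n * (D'^[n]) a - (-1) ^ n * (n.factorial : S) * a := by
    intro n
    induction n with
    | zero => simp
    | succ n ih =>
      have h1 := (hstable _ ih).mul_left y
      have h2 := hstable _ h
      have h3 := ih
      have e1 : D' (y ^ n * (D'^[n]) a - (-1) ^ n * (n.factorial : S) * a) =
          y ^ n * (D'^[n + 1]) a + n * y ^ (n - 1) * (D'^[n]) a
            - (-1) ^ n * (n.factorial : S) * D' a := by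
        have : D' ((-1) ^ n * (n.factorial : S)) = 0 := by
          have := D'.map_intCast ((-1) ^ n * n.factorial)
          push_cast at this
          exact this
        rw [map_sub, D'.leibniz, D'.leibniz, this, D'.leibniz_pow, hy',
          Function.iterate_succ_apply']
        simp only [smul_eq_mul, nsmul_eq_mul]
        ring
      rw [e1] at h1
      have e2 : D' (y * a) = y * D' a + a := by simp [D'.leibniz, hy']
      rw [e2] at h2
      have e3 : y * (n * y ^ (n - 1) * (D'^[n]) a) = n * (y ^ n * (D'^[n]) a) := by
        cases n with
        | zero => simp
        | succ n => simp only [Nat.add_sub_cancel]; ring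
      have := (h1.sub (h3.mul_left (n : S))).add (h2.mul_left ((-1) ^ n * (n.factorial : S)))
      convert this using 1
      rw [mul_sub, mul_add, e3, Nat.factorial_succ]
      push_cast
      ring
  by_contra ha
  let I : Ideal S := Ideal.span {x}
  have hI : I ≠ ⊤ := fun h => ha (Ideal.mem_span_singleton.mp (h ▸ Submodule.mem_top : a ∈ I))
  have : Nontrivial (S ⧸ I) := Ideal.Quotient.nontrivial_iff.mpr hI
  have : IsLocalRing (S ⧸ I) := .of_surjective' (Ideal.Quotient.mk I) Ideal.Quotient.mk_surjective
  apply ha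
  rw [← Ideal.mem_span_singleton, ← Ideal.Quotient.eq_zero_iff_mem, ← Ideal.mem_bot,
    ← Ideal.iInf_pow_eq_bot_of_isLocalRing (maximalIdeal (S ⧸ I)) Ideal.IsPrime.ne_top',
    Ideal.mem_iInf]
  intro n
  have hn := key n
  rw [← Ideal.mem_span_singleton, ← Ideal.Quotient.eq_zero_iff_mem, map_sub, sub_eq_zero] at hn
  have hunit : IsUnit ((-1) ^ n * (n.factorial : S)) := by
    refine (isUnit_one.neg.pow n).mul ?_
    rw [← map_natCast (algebraMap E S)]
    exact (isUnit_iff_ne_zero.mpr (Nat.cast_ne_zero.mpr n.factorial_ne_zero)).map _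
  rw [map_mul] at hn
  rw [← Ideal.unit_mul_mem_iff_mem _ (hunit.map (Ideal.Quotient.mk I)), ← map_mul]
  refine hn ▸ ?_
  rw [map_pow]
  refine Ideal.mul_mem_right _ _ (Ideal.pow_mem_pow ?_ n)
  have := IsLocalHom.of_surjective (Ideal.Quotient.mk I) Ideal.Quotient.mk_surjective
  exact map_nonunit (Ideal.Quotient.mk I) y hym

/-- For a local ring over a field of characteristic zero with free differentials, linear forms on
the Zariski cotangent space lift to derivations. -/
lemma exists_derivation_residue_eq {E S : Type u} [Field E] [CharZero E] [CommRing S]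
    [IsLocalRing S] [Algebra E S] [Algebra.EssFiniteType E S] [Module.Projective S Ω[S⁄E]]
    (μ : CotangentSpace S →ₗ[ResidueField S] ResidueField S) :
    ∃ D : Derivation E S S, ∀ x : maximalIdeal S,
      residue S (D x) = μ ((maximalIdeal S).toCotangent x) := by
  let κ := ResidueField S
  have hsurj : Function.Surjective (algebraMap S κ) := IsLocalRing.residue_surjective
  have : Algebra.EssFiniteType S κ := inferInstance
  have : Algebra.EssFiniteType E κ := Algebra.EssFiniteType.comp E S κ
  have : Algebra.FormallySmooth E κ := inferInstance
  let q := (IsScalarTower.toAlgHom E S κ).kerSquareLift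
  have hq : Function.Surjective q := fun c => by
    obtain ⟨x, rfl⟩ := hsurj c
    exact ⟨Ideal.Quotient.mk _ x, rfl⟩
  have hqnil : IsNilpotent (RingHom.ker q.toRingHom) := by
    refine ⟨2, ?_⟩
    have := AlgHom.ker_kerSquareLift (IsScalarTower.toAlgHom E S κ)
    exact this ▸ Ideal.cotangentIdeal_square _
  -- Formal smoothness of `κ` over `E` gives a section of `S/𝔪² → κ`, equivalently a retraction `ρ`
  -- of the conormal map `𝔪/𝔪² → κ ⊗ Ω_S`.
  obtain ⟨ρ, hρ⟩ := (retractionKerCotangentToTensorEquivSection (R := E) hsurj).symm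
    ⟨_, Algebra.FormallySmooth.comp_liftOfSurjective (AlgHom.id E κ) q hq hqnil⟩
  let ι : (RingHom.ker (algebraMap S κ)).Cotangent →ₗ[S] (maximalIdeal S).Cotangent :=
    Ideal.mapCotangent _ _ (AlgHom.id S S) (IsLocalRing.ker_residue (R := S)).le
  let ν : Ω[S⁄E] →ₗ[S] κ :=
    μ.restrictScalars S ∘ₗ ι ∘ₗ ρ ∘ₗ TensorProduct.mk S κ Ω[S⁄E] 1
  -- Projectivity of `Ω_S` lifts `μ ∘ ρ` from `κ`-valued to `S`-valued.
  obtain ⟨ν', hν'⟩ := Module.projective_lifting_property (Algebra.linearMap S κ) ν hsurj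
  refine ⟨ν'.compDer (KaehlerDifferential.D E S), fun x => ?_⟩
  have h1 := LinearMap.congr_fun hν' (KaehlerDifferential.D E S x)
  refine h1.trans ?_
  have hx : (x : S) ∈ RingHom.ker (algebraMap S κ) := (IsLocalRing.ker_residue (R := S)).ge x.2
  have h2 := LinearMap.congr_fun hρ (Ideal.toCotangent _ ⟨x, hx⟩)
  change μ (ι (ρ (1 ⊗ₜ KaehlerDifferential.D E S x))) = _
  rw [LinearMap.comp_apply, KaehlerDifferential.kerCotangentToTensor_toCotangent] at h2
  rw [h2]
  rfl

/-- The hypotheses say that `𝔪` kills a nonzero class of `S / bS`. With two independent cotangent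
vectors `x₀, x₁`, the relations `xᵢ a = b cᵢ` give `x₁ c₀ = x₀ c₁`. As `x₁` is regular modulo `x₀`,
it follows that `x₀ ∣ c₀` and then `b ∣ a`. -/
lemma isDiscreteValuationRing_of_free {E S : Type u} [Field E] [CharZero E] [CommRing S]
    [IsDomain S] [IsLocalRing S] [IsNoetherianRing S] [Algebra E S] [Algebra.EssFiniteType E S]
    [Module.Projective S Ω[S⁄E]] {a b : S} (hb : b ≠ 0) (hab : ¬ b ∣ a)
    (h : ∀ x ∈ maximalIdeal S, b ∣ x * a) : IsDiscreteValuationRing S := by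
  have hF : ¬ IsField S := fun hF => by
    obtain ⟨c, hc⟩ := hF.mul_inv_cancel hb
    exact hab ⟨c * a, by rw [← mul_assoc, hc, one_mul]⟩
  by_contra hS
  have hrank : 2 ≤ Module.finrank (ResidueField S) (CotangentSpace S) := by
    have h1 := mt IsLocalRing.finrank_CotangentSpace_eq_one_iff.mp hS
    have h0 := mt IsLocalRing.finrank_cotangentSpace_eq_zero_iff.mp hF
    omega
  obtain ⟨v, hv⟩ := exists_linearIndependent_of_le_finrank hrank
  choose x hx using fun i => (maximalIdeal S).toCotangent_surjective (v i)
  obtain ⟨c, hc⟩ : ∃ c : Module.Dual (ResidueField S) (CotangentSpace S) ×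
      Module.Dual (ResidueField S) (CotangentSpace S),
      c.1 (v 0) = 1 ∧ c.1 (v 1) = 0 ∧ c.2 (v 1) = 1 ∧ c.2 (v 0) = 0 := by
    obtain ⟨g, hg⟩ := LinearMap.exists_leftInverse_of_injective _
      (LinearMap.ker_eq_bot.mpr hv)
    have hgv : ∀ i, g (v i) = Finsupp.single i 1 := fun i => by
      simpa using LinearMap.congr_fun hg (Finsupp.single i 1)
    exact ⟨(Finsupp.lapply 0 ∘ₗ g, Finsupp.lapply 1 ∘ₗ g), by simp [hgv]⟩
  obtain ⟨D₁, hD₁⟩ := exists_derivation_residue_eq (E := E) c.1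
  obtain ⟨D₂, hD₂⟩ := exists_derivation_residue_eq (E := E) c.2
  -- `D₁, D₂` are dual to `x 0, x 1` only modulo `𝔪`. This combination kills `x 0` exactly and still
  -- sends `x 1` to an element of residue 1.
  let D : Derivation E S S := D₁ (x 0) • D₂ - D₂ (x 0) • D₁
  have hD0 : D (x 0) = 0 := by simp [D, mul_comm]
  have hD1 : IsUnit (D (x 1)) := by
    rw [← IsLocalRing.residue_ne_zero_iff_isUnit]
    simp [D, hD₁, hD₂, hx, hc]
  obtain ⟨c₀, h0⟩ := h (x 0) (x 0).2
  obtain ⟨c₁, h1⟩ := h (x 1) (x 1).2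
  have hx0 : (x 0 : S) ≠ 0 := fun h => by
    have := hc.1
    rw [← hx, show x 0 = 0 from Subtype.ext h] at this
    simp at this
  have hdvd : (x 0 : S) ∣ x 1 * c₀ :=
    ⟨c₁, mul_left_cancel₀ hb (by linear_combination x 0 * h1 - x 1 * h0)⟩
  obtain ⟨e, rfl⟩ := dvd_of_dvd_mul_of_derivation D hD0 hD1 (x 1).2 hdvd
  exact hab ⟨e, mul_left_cancel₀ hx0 (by linear_combination h0)⟩

end Derivation

/-! ### Divisorial valuation rings cutting out a regular local ring. -/

section Divisorial

lemma trdeg_eq_of_isFractionRing (E R K : Type u) [Field E] [CommRing R] [IsDomain R] [Algebra E R]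
    [Field K] [Algebra R K] [Algebra E K] [IsScalarTower E R K] [IsFractionRing R K] :
    Algebra.trdeg E R = Algebra.trdeg E K := by
  have : Algebra.IsAlgebraic R K := IsLocalization.isAlgebraic K (nonZeroDivisors R)
  have : FaithfulSMul R K :=
    (faithfulSMul_iff_algebraMap_injective R K).mpr (IsFractionRing.injective R K)
  have := trdeg_add_eq E R (A := K)
  rwa [trdeg_eq_zero (R := R), add_zero] at this

lemma exists_basis_kaehlerDifferential_of_isLocalization {E R : Type*} (S : Type*) [CommRing E]
    [CommRing R] [CommRing S] [Algebra E R] [Algebra R S] [Algebra E S] [IsScalarTower E R S]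
    (M : Submonoid R) [IsLocalization M S] {ι : Type*} {x : ι → R}
    (b : Module.Basis ι R Ω[R⁄E]) (hb : ∀ i, b i = KaehlerDifferential.D E R (x i)) :
    ∃ b' : Module.Basis ι S Ω[S⁄E],
      ∀ i, b' i = KaehlerDifferential.D E S (algebraMap R S (x i)) :=
  ⟨b.ofIsLocalizedModule S M (KaehlerDifferential.map E E R S), fun i => by
    rw [Module.Basis.ofIsLocalizedModule_apply, hb, KaehlerDifferential.map_D]⟩

/-- An element of the fraction field not in `R` is not in the localization at a prime `P` such that
some `y ∉ bR_P` is multiplied into `bR_P` by the maximal ideal. -/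
lemma exists_isPrime_of_notMem_range {R K : Type*} [CommRing R] [IsDomain R] [IsNoetherianRing R]
    [Field K] [Algebra R K] [IsFractionRing R K] {f : K} (hf : f ∉ (algebraMap R K).range) :
    ∃ (P : Ideal R) (_ : P.IsPrime) (y b : R), b ≠ 0 ∧ (∀ s, b ∣ s * y ↔ s ∈ P) ∧
      ∀ r, ∀ s ∉ P, f * algebraMap R K s ≠ algebraMap R K r := by
  obtain ⟨a, b, hb, rfl⟩ := IsFractionRing.div_surjective (A := R) f
  have hb0 : b ≠ 0 := nonZeroDivisors.ne_zero hb
  have hbK : algebraMap R K b ≠ 0 :=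
    (map_ne_zero_iff _ (IsFractionRing.injective R K)).mpr hb0
  have ha : (Ideal.Quotient.mk (Ideal.span {b}) a) ≠ 0 := by
    rw [Ne, Ideal.Quotient.eq_zero_iff_mem, Ideal.mem_span_singleton]
    rintro ⟨c, rfl⟩
    exact hf ⟨c, by rw [map_mul]; field_simp⟩
  -- `P` is an associated prime of `R / bR` containing the annihilator of the class of `a`. If
  -- `(a/b) s ∈ R`, then `s` kills that class, so `s ∈ P`.
  obtain ⟨P, hP, hle⟩ := exists_le_isAssociatedPrime_of_isNoetherianRing R _ ha
  obtain ⟨hP, y, hy⟩ := isAssociatedPrime_iff.mp hP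
  obtain ⟨y, rfl⟩ := Ideal.Quotient.mk_surjective y
  have hmem : ∀ s z : R, s ∈ (⊥ : Submodule R (R ⧸ Ideal.span {b})).colon
      {Ideal.Quotient.mk (Ideal.span {b}) z} ↔ b ∣ s * z := fun s z => by
    rw [Submodule.mem_colon_singleton, Submodule.mem_bot, ← Ideal.mem_span_singleton,
      ← Ideal.Quotient.eq_zero_iff_mem, map_mul, Algebra.smul_def, Ideal.Quotient.algebraMap_eq]
  refine ⟨P, hP, y, b, hb0, fun s => by rw [hy, hmem], fun r s hs h => hs (hle ?_)⟩
  rw [hmem]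
  refine ⟨r, IsFractionRing.injective R K ?_⟩
  rw [map_mul, map_mul, ← h]
  field_simp

/-- A local ring of a prime `P` of `R` that is a discrete valuation ring, with the prescribed
differentials of `R` as a basis of its differentials, is divisorial. -/
lemma trdeg_residueField_add_one {E A : Type u} [Field E] [CharZero E] [CommRing A] [IsDomain A]
    [IsDiscreteValuationRing A] [Algebra E A] [Module.Finite A Ω[A⁄E]] {l : ℕ}
    (hl : Algebra.trdeg E A = l) (b : Module.Basis (Fin l) A Ω[A⁄E]) :
    Algebra.trdeg E (ResidueField A) + 1 = l := by
  have hle : Algebra.trdeg E (ResidueField A) + 1 ≤ l := by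
    rw [← hl]
    refine trdeg_add_one_le_of_surjective (IsScalarTower.toAlgHom E A (ResidueField A))
      IsLocalRing.residue_surjective fun h => ?_
    refine IsDiscreteValuationRing.not_a_field A ?_
    rw [← IsLocalRing.ker_residue]
    exact (RingHom.injective_iff_ker_eq_bot _).mp h
  obtain ⟨t, ht⟩ := Cardinal.lt_aleph0.mp (lt_of_le_of_lt (self_le_add_right _ 1)
    (hle.trans_lt Cardinal.natCast_lt_aleph0))
  -- For the reverse inequality, the fibre of `Ω_A` has dimension `l`, at most 1 (a uniformizer)
  -- plus the transcendence degree of the residue field.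
  have h1 := finrank_residueField_tensor_kaehlerDifferential_le (E := E) (R := A)
  rw [(finrank_kaehlerDifferential_eq_trdeg ht).1,
    spanFinrank_maximalIdeal_eq_finrank_cotangentSpace, IsLocalRing.finrank_CotangentSpace_eq_one,
    Module.finrank_eq_card_basis (b.baseChange (ResidueField A)), Fintype.card_fin] at h1
  rw [ht] at hle ⊢
  norm_cast at hle ⊢
  omega

/-- A regular local ring `R`, essentially of finite type over a field of characteristic zero, has
free differentials, and is cut out of its field of fractions by divisorial valuation rings whose
differentials have the same basis. -/
theorem exists_basis_and_divisorialValuationRing {E R K : Type u} [Field E] [CharZero E]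
    [CommRing R]
    [IsDomain R] [Algebra E R] [Field K] [Algebra R K] [Algebra E K] [IsScalarTower E R K]
    [IsFractionRing R K] [Algebra.EssFiniteType E R] (hR : IsRegularLocalRing R) {l : ℕ}
    (hl : Algebra.trdeg E K = l) :
    ∃ x : Fin l → R,
      (∃ b : Module.Basis (Fin l) K Ω[K⁄E],
        ∀ i, b i = KaehlerDifferential.D E K (algebraMap R K (x i))) ∧
      ∀ f : K, f ∉ (algebraMap R K).range →
        ∃ (A : DivisorialValuationRing E K l) (hA : ∀ r, algebraMap R K r ∈ A.ring), f ∉ A.ring ∧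
          ∃ b : Module.Basis (Fin l) A.ring Ω[A.ring⁄E],
            ∀ i, b i = KaehlerDifferential.D E A.ring ⟨algebraMap R K (x i), hA _⟩ := by
  have hlR := (trdeg_eq_of_isFractionRing E R K).trans hl
  obtain ⟨hrank, -⟩ := finrank_kaehlerDifferential_eq_trdeg hl
  have hle : Module.finrank (ResidueField R) (ResidueField R ⊗[R] Ω[R⁄E]) ≤ l := by
    -- Regularity enters here: `𝔪` is generated by `dim R` elements, so the fibre of `Ω_R` has
    -- dimension at most `dim R + trdeg κ ≤ l`.
    have h1 := ringKrullDim_add_trdeg_residueField_le hlR hR.spanFinrank_maximalIdeal.le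
    obtain ⟨t, ht⟩ := Cardinal.lt_aleph0.mp (lt_of_le_of_lt (self_le_add_left _ _)
      (h1.trans_lt Cardinal.natCast_lt_aleph0))
    have h2 := finrank_residueField_tensor_kaehlerDifferential_le (E := E) (R := R)
    rw [(finrank_kaehlerDifferential_eq_trdeg ht).1] at h2
    rw [ht] at h1
    norm_cast at h1
    exact h2.trans h1
  obtain ⟨x, b, hb⟩ := exists_basis_kaehlerDifferential hrank hle
  refine ⟨x, exists_basis_kaehlerDifferential_of_isLocalization K (nonZeroDivisors R) b hb,
    fun f hf => ?_⟩
  obtain ⟨P, hP, y, c, hc, hy, hfP⟩ := exists_isPrime_of_notMem_range hf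
  let S := Localization.AtPrime P
  obtain ⟨bS, -⟩ := exists_basis_kaehlerDifferential_of_isLocalization S P.primeCompl b hb
  have : Algebra.EssFiniteType R S := .of_isLocalization S P.primeCompl
  have : Algebra.EssFiniteType E S := .comp E R S
  have : IsNoetherianRing S := IsLocalization.isNoetherianRing P.primeCompl S inferInstance
  have : Module.Free S Ω[S⁄E] := .of_basis bS
  have hinj : Function.Injective (algebraMap R S) :=
    IsLocalization.injective S P.primeCompl_le_nonZeroDivisors
  have hdvd : ∀ s z : R, algebraMap R S s ∣ algebraMap R S z ↔ ∃ t ∉ P, s ∣ t * z := by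
    intro s z
    constructor
    · rintro ⟨w, hw⟩
      obtain ⟨r, t, rfl⟩ := IsLocalization.exists_mk'_eq P.primeCompl w
      refine ⟨t, t.2, r, hinj ?_⟩
      rw [map_mul, map_mul, hw, mul_comm, mul_assoc, IsLocalization.mk'_spec]
    · rintro ⟨t, ht, h⟩
      have hu : IsUnit (algebraMap R S t) := IsLocalization.map_units S (⟨t, ht⟩ : P.primeCompl)
      have := map_dvd (algebraMap R S) h
      rwa [map_mul, hu.dvd_mul_left] at this
  have hDVR : IsDiscreteValuationRing S := by
    refine isDiscreteValuationRing_of_free (E := E) (a := algebraMap R S y) (b := algebraMap R S c)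
      ((map_ne_zero_iff _ hinj).mpr hc) ?_ fun z hz => ?_
    · rw [hdvd]
      rintro ⟨t, ht, h⟩
      exact ht ((hy t).mp h)
    · obtain ⟨r, t, rfl⟩ := IsLocalization.exists_mk'_eq P.primeCompl z
      have hr : r ∈ P := (IsLocalization.AtPrime.mk'_mem_maximal_iff S P r t).mp hz
      rw [IsLocalization.mk'_eq_mul_mk'_one, mul_right_comm, ← map_mul]
      exact (map_dvd (algebraMap R S) ((hy r).mpr hr)).mul_right _
  let : Algebra S K := IsLocalization.localizationAlgebraOfSubmonoidLe S K P.primeCompl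
    (nonZeroDivisors R) P.primeCompl_le_nonZeroDivisors
  have : IsScalarTower R S K := IsLocalization.localization_isScalarTower_of_submonoid_le S K
    P.primeCompl (nonZeroDivisors R) P.primeCompl_le_nonZeroDivisors
  have : IsFractionRing S K :=
    IsFractionRing.isFractionRing_of_isDomain_of_isLocalization P.primeCompl S K
  -- `A` is the image of `R_P` in `K`. Being a localization of `R`, it inherits the basis `dx_i`.
  obtain ⟨A, hA⟩ : ∃ A : ValuationRingOver E K, ∀ z, z ∈ A.ring ↔ z ∈ (algebraMap S K).range :=
    ⟨⟨.ofSubring (algebraMap S K).range fun z => ValuationRing.isInteger_or_isInteger S z, fun e =>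
      ⟨algebraMap R S (algebraMap E R e), by
        rw [← IsScalarTower.algebraMap_apply R S K, ← IsScalarTower.algebraMap_apply E R K]⟩⟩,
      fun z => Iff.rfl⟩
  have hRA : ∀ r, algebraMap R K r ∈ A.ring := fun r =>
    (hA _).mpr ⟨algebraMap R S r, (IsScalarTower.algebraMap_apply R S K r).symm⟩
  let : Algebra R A.ring := ((algebraMap R K).codRestrict A.ring.toSubring hRA).toAlgebra
  have : IsScalarTower E R A.ring := IsScalarTower.of_algebraMap_eq fun e =>
    Subtype.ext (IsScalarTower.algebraMap_apply E R K e)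
  let e : S ≃+* A.ring := RingEquiv.ofBijective
    ((algebraMap S K).codRestrict A.ring.toSubring fun z => (hA _).mpr ⟨z, rfl⟩)
    ⟨fun z w h => IsFractionRing.injective S K (congrArg Subtype.val h), fun z => by
      obtain ⟨w, hw⟩ := (hA _).mp z.2
      exact ⟨w, Subtype.ext hw⟩⟩
  let e' : S ≃ₐ[R] A.ring := AlgEquiv.ofRingEquiv (f := e) fun r =>
    Subtype.ext (IsScalarTower.algebraMap_apply R S K r).symm
  have : IsLocalization P.primeCompl A.ring := IsLocalization.isLocalization_of_algEquiv _ e'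
  have hDVR' : IsDiscreteValuationRing A.ring :=
    IsDiscreteValuationRing.RingEquivClass.isDiscreteValuationRing e
  obtain ⟨bA, hbA⟩ :=
    exists_basis_kaehlerDifferential_of_isLocalization A.ring P.primeCompl b hb
  have : Module.Finite A.ring Ω[A.ring⁄E] := .of_basis bA
  have hlA := (trdeg_eq_of_isFractionRing E A.ring K).trans hl
  refine ⟨⟨A, hDVR', trdeg_residueField_add_one hlA bA⟩, hRA, ?_, bA, hbA⟩
  intro hfA
  obtain ⟨z, hz⟩ := (hA f).mp hfA
  obtain ⟨r, t, rfl⟩ := IsLocalization.exists_mk'_eq P.primeCompl z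
  refine hfP r t t.2 ?_
  rw [← hz, IsScalarTower.algebraMap_apply R S K, IsScalarTower.algebraMap_apply R S K,
    ← map_mul, IsLocalization.mk'_spec]

end Divisorial

/-! ### Dimension of `X` as the transcendence degree of its function field. -/

section Dimension

/-- By Noether normalization `B` is integral over a polynomial ring in `s` variables; a chain of `s
+ 1` primes there lifts to `B` by going up. -/
lemma trdeg_le_ringKrullDim {E B : Type u} [Field E] [CommRing B] [IsDomain B] [Algebra E B]
    [Algebra.FiniteType E B] : ∃ l : ℕ, Algebra.trdeg E B = l ∧ l ≤ ringKrullDim B := by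
  obtain ⟨s, g, hg, hgi⟩ := exists_integral_inj_algHom_of_fg E B
  let P := MvPolynomial (Fin s) E
  let : Algebra P B := g.toRingHom.toAlgebra
  have : IsScalarTower E P B := IsScalarTower.of_algHom g
  have : Algebra.IsIntegral P B := ⟨hgi⟩
  have hinj : Function.Injective (algebraMap P B) := hg
  have : FaithfulSMul P B := (faithfulSMul_iff_algebraMap_injective _ _).mpr hinj
  refine ⟨s, ?_, ?_⟩
  · have h1 := lift_trdeg_add_eq E P (A := B)
    rw [trdeg_eq_zero (R := P), MvPolynomial.trdeg_of_isDomain] at h1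
    simpa using h1.symm
  · have hdim : (s : WithBot ℕ∞) ≤ ringKrullDim P := by
      rw [MvPolynomial.ringKrullDim_of_isNoetherianRing, ringKrullDim_eq_zero_of_field]
      simp
    obtain ⟨p, hp⟩ := Order.le_krullDim_iff.mp hdim
    obtain ⟨Q, hQ, hQp⟩ := Ideal.exists_ideal_over_prime_of_isIntegral_of_isDomain
      (S := B) p.head.asIdeal (by
        rw [(RingHom.injective_iff_ker_eq_bot _).mp hinj]; exact bot_le)
    have : Q.LiesOver p.head.asIdeal := ⟨hQp.symm⟩
    obtain ⟨L, hL, -⟩ := Ideal.exists_ltSeries_of_hasGoingUp p Q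
    exact Order.le_krullDim_iff.mpr ⟨L, hL.trans hp⟩

variable {E : Type u} [Field E] {X : Scheme.{u}} [X.Over (Spec (.of E))]
  [LocallyOfFiniteType (X ↘ Spec (.of E))]

lemma finiteType_sections {U : X.Opens} (hU : IsAffineOpen U) : Algebra.FiniteType E Γ(X, U) := by
  have h := (X ↘ Spec (.of E)).finiteType_appLE (isAffineOpen_top _) hU le_top
  have h' : ((Scheme.ΓSpecIso (.of E)).inv.hom).FiniteType :=
    RingHom.FiniteType.of_surjective _
      (ConcreteCategory.bijective_of_isIso (Scheme.ΓSpecIso (.of E)).inv).2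
  have h'' := h.comp h'
  exact h''

variable [IsIntegral X]

lemma exists_algebra_stalk (p : X) : ∃ _ : Algebra E (X.presheaf.stalk p),
    IsScalarTower E (X.presheaf.stalk p) X.functionField ∧
      Algebra.EssFiniteType E (X.presheaf.stalk p) := by
  obtain ⟨U, hU, hpU, -⟩ := exists_isAffineOpen_mem_and_subset (x := p) (U := (⊤ : X.Opens)) trivial
  have : Nonempty U := ⟨⟨p, hpU⟩⟩
  let : Algebra Γ(X, U) (X.presheaf.stalk p) := X.presheaf.algebra_section_stalk ⟨p, hpU⟩
  have hloc := hU.isLocalization_stalk ⟨p, hpU⟩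
  have : IsScalarTower Γ(X, U) (X.presheaf.stalk p) X.functionField :=
    functionField_isScalarTower X U ⟨p, hpU⟩
  let : Algebra E (X.presheaf.stalk p) := ((algebraMap Γ(X, U) _).comp (algebraMap E _)).toAlgebra
  have : IsScalarTower E Γ(X, U) (X.presheaf.stalk p) := IsScalarTower.of_algebraMap_eq' rfl
  have := finiteType_sections (E := E) hU
  have : Algebra.EssFiniteType Γ(X, U) (X.presheaf.stalk p) :=
    .of_isLocalization _ (hU.primeIdealOf ⟨p, hpU⟩).asIdeal.primeCompl
  refine ⟨inferInstance, .of_algebraMap_eq fun e => ?_, .comp E Γ(X, U) _⟩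
  rw [IsScalarTower.algebraMap_apply E Γ(X, U) X.functionField,
    IsScalarTower.algebraMap_apply E Γ(X, U) (X.presheaf.stalk p),
    ← IsScalarTower.algebraMap_apply Γ(X, U) (X.presheaf.stalk p)]

/-- An affine open set bounds the dimension of `X` from below by the transcendence degree. From
above, the dimension is the supremum of the dimensions of the stalks, each bounded by the chain
estimate. -/
theorem trdeg_functionField {l : ℕ} (hl : topologicalKrullDim X = l) :
    Algebra.trdeg E X.functionField = l := by
  obtain ⟨U, hU, hpU, -⟩ :=
    exists_isAffineOpen_mem_and_subset (x := genericPoint X) (U := (⊤ : X.Opens)) trivial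
  have : Nonempty U := ⟨⟨_, hpU⟩⟩
  have := functionField_isFractionRing_of_isAffineOpen X U hU
  have := finiteType_sections (E := E) hU
  obtain ⟨n, hn, hn'⟩ := trdeg_le_ringKrullDim (E := E) (B := Γ(X, U))
  rw [trdeg_eq_of_isFractionRing E Γ(X, U) X.functionField] at hn
  have h1 : (n : WithBot ℕ∞) ≤ topologicalKrullDim X := by
    refine hn'.trans ?_
    rw [← PrimeSpectrum.topologicalKrullDim_eq_ringKrullDim Γ(X, U)]
    change topologicalKrullDim (Spec Γ(X, U)) ≤ _
    rw [← IsHomeomorph.topologicalKrullDim_eq _ hU.isoSpec.hom.homeomorph.isHomeomorph]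
    exact topologicalKrullDim_subspace_le X U
  have h2 : topologicalKrullDim X ≤ n := by
    rw [topologicalKrullDim, Order.krullDim_eq_of_orderIso irreducibleSetEquivPoints,
      Order.krullDim_eq_iSup_coheight]
    refine iSup_le fun p => ?_
    rw [← ringKrullDim_stalk_eq_coheight p]
    obtain ⟨_, _, _⟩ := exists_algebra_stalk (E := E) p
    rw [← trdeg_eq_of_isFractionRing E (X.presheaf.stalk p) X.functionField] at hn
    by_contra! hlt
    have h3 : ((n + 1 : ℕ) : WithBot ℕ∞) ≤ ringKrullDim (X.presheaf.stalk p) := by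
      push_cast
      exact ENat.WithBot.add_one_le_iff.mpr hlt
    have h4 := (self_le_add_right _ _).trans (ringKrullDim_add_trdeg_residueField_le hn h3)
    norm_cast at h4
    omega
  rw [hn]
  have := h2.antisymm h1
  rw [hl] at this
  norm_cast at this ⊢
  exact this.symm

end Dimension

/-! ### Forms along the completion of a divisorial valuation ring. -/

namespace DivisorialValuationRing

variable {E K : Type u} [Field E] [Field K] [Algebra E K] {l : ℕ}
  (A : DivisorialValuationRing E K l)

/-- The intersection of `Â` with `K` inside `Q(Â)` is `A`. -/
lemma mem_ring_of_algebraMap_eq {z : K} {y : A.Completion}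
    (h : algebraMap A.Completion A.CompletionField y = algebraMap K A.CompletionField z) :
    z ∈ A.ring := by
  by_contra hz
  have hz0 : z ≠ 0 := by
    rintro rfl
    exact hz A.ring.zero_mem
  let w : A.ring := ⟨z⁻¹, (A.ring.mem_or_inv_mem z).resolve_left hz⟩
  have hw : w ∈ maximalIdeal A.ring := by
    rw [mem_maximalIdeal, mem_nonunits_iff]
    intro hu
    obtain ⟨v, hv⟩ := hu.exists_right_inv
    have h1 : z⁻¹ * (v : K) = 1 := congrArg (algebraMap A.ring K) hv
    have h2 : (v : K) = z := by
      field_simp at h1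
      exact h1
    exact hz (h2 ▸ v.2)
  -- If `z ∉ A`, its inverse `w` lies in the maximal ideal; then `w * y = 1` contradicts the
  -- vanishing of `w` in the residue field.
  have h1 : algebraMap A.ring A.Completion w * y = 1 := by
    apply IsFractionRing.injective A.Completion A.CompletionField
    rw [map_mul, map_one, h, ← IsScalarTower.algebraMap_apply A.ring A.Completion,
      IsScalarTower.algebraMap_apply A.ring K, ← map_mul]
    change algebraMap K A.CompletionField (z⁻¹ * z) = 1
    rw [inv_mul_cancel₀ hz0, map_one]
  have h2 := congrArg (AdicCompletion.evalOneₐ (maximalIdeal A.ring)) h1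
  rw [map_mul, map_one, AlgHom.commutes, Ideal.Quotient.algebraMap_eq,
    Ideal.Quotient.eq_zero_iff_mem.mpr hw, zero_mul] at h2
  exact zero_ne_one h2

lemma ratDifferentialMap_D_algebraMap (a : A.ring) :
    A.ratDifferentialMap (KaehlerDifferential.D E K (algebraMap A.ring K a)) =
      1 ⊗ₜ KaehlerDifferential.D E A.ring a := by
  rw [ratDifferentialMap, LinearMap.comp_apply, LinearEquiv.coe_coe,
    KaehlerDifferential.tensorKaehlerEquivOfFormallyEtale_symm_D_algebraMap,
    TensorProduct.AlgebraTensorModule.map_tmul, Algebra.linearMap_apply, map_one,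
    LinearMap.id_apply]

lemma differentialsToRat_tmul (a : A.Completion) (ω : Ω[A.ring⁄E]) :
    A.differentialsToRat (a ⊗ₜ ω) = algebraMap A.Completion A.CompletionField a ⊗ₜ ω := by
  simp [differentialsToRat]

/-- Forms that come from a ring contained in `A` are regular along `A`. -/
lemma pluriMap_map_mem_range (B : Type u) [CommRing B] [Algebra E B] [Algebra B A.ring]
    [Algebra B K] [IsScalarTower E B K] [IsScalarTower E B A.ring] [IsScalarTower B A.ring K]
    (m : ℕ) (θ : Pluri B Ω[B⁄E] l m) :
    pluriMap A.CompletionField A.ratDifferentialMap l m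
        (pluriMap K (KaehlerDifferential.map E E B K) l m θ) ∈
      LinearMap.range (pluriMap A.CompletionField A.differentialsToRat l m) := by
  have : IsScalarTower B A.ring A.CompletionField := inferInstance
  have : IsScalarTower B K A.CompletionField := .of_algebraMap_eq fun b => by
    rw [IsScalarTower.algebraMap_apply B A.ring K, ← IsScalarTower.algebraMap_apply A.ring K,
      ← IsScalarTower.algebraMap_apply B A.ring]
  let g : Ω[A.ring⁄E] →ₗ[A.ring] A.RatDifferentials :=
    TensorProduct.mk A.ring A.CompletionField _ 1
  let g' : Ω[A.ring⁄E] →ₗ[A.ring] A.Differentials := TensorProduct.mk A.ring A.Completion _ 1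
  let f := KaehlerDifferential.map E E B A.ring
  have h1 : ∀ ω, A.ratDifferentialMap (KaehlerDifferential.map E E B K ω) =
      (g.restrictScalars B ∘ₗ f) ω := by
    intro ω
    have hω : ω ∈ Submodule.span B (Set.range (KaehlerDifferential.D E B)) := by
      rw [KaehlerDifferential.span_range_derivation]; trivial
    induction hω using Submodule.span_induction with
    | mem x hx =>
      obtain ⟨b, rfl⟩ := hx
      rw [KaehlerDifferential.map_D, IsScalarTower.algebraMap_apply B A.ring K,
        ratDifferentialMap_D_algebraMap]
      simp [f, g, KaehlerDifferential.map_D]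
    | zero => simp
    | add x y _ _ hx hy => rw [map_add, map_add, hx, hy, map_add]
    | smul b x _ hx =>
      rw [map_smul (KaehlerDifferential.map E E B K), map_smul (g.restrictScalars B ∘ₗ f), ← hx,
        ← algebraMap_smul K b, map_smul A.ratDifferentialMap, algebraMap_smul]
  -- The preimage is `θ` pushed to `A` and then to `Â`; both routes to the forms of `Q(Â)` agree by
  -- functoriality.
  refine ⟨pluriMap A.Completion g' l m (pluriMap A.ring f l m θ), ?_⟩
  rw [pluriMap_pluriMap _ _ g (fun ω => by simp [g, g', differentialsToRat_tmul]),
    pluriMap_pluriMap f g (g.restrictScalars B ∘ₗ f) (fun _ => rfl),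
    pluriMap_pluriMap _ _ _ h1]

end DivisorialValuationRing

/-! ### Regular forms are adjoint. -/

section Scheme

/-- Together with the next lemma, this turns the equation `generic_comp_hom` of morphisms into an
equation of ring maps `Γ(X, V) → Q(Â)`. -/
lemma comp_appLE_ΓSpecIso_hom {X : Scheme.{u}} {R S : CommRingCat.{u}} (f : Spec R ⟶ X) (g : R ⟶ S)
    {V : X.Opens} (h : ⊤ ≤ f ⁻¹ᵁ V) :
    (Spec.map g ≫ f).appLE V ⊤ (fun _ _ => h trivial) ≫ (Scheme.ΓSpecIso S).hom =
      (f.appLE V ⊤ h ≫ (Scheme.ΓSpecIso R).hom) ≫ g := by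
  rw [Category.assoc, ← Scheme.ΓSpecIso_naturality, ← Category.assoc, Scheme.Hom.appTop,
    Scheme.Hom.app_eq_appLE]
  congr 1

lemma fromSpecStalk_appLE_ΓSpecIso_hom {X : Scheme.{u}} {x : X} {V : X.Opens} (hx : x ∈ V)
    (h : ⊤ ≤ X.fromSpecStalk x ⁻¹ᵁ V) :
    (X.fromSpecStalk x).appLE V ⊤ h ≫ (Scheme.ΓSpecIso (X.presheaf.stalk x)).hom =
      X.presheaf.germ V x hx := by
  rw [Scheme.Hom.appLE, Scheme.fromSpecStalk_app hx]
  simp only [Category.assoc]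
  rw [← Functor.map_comp_assoc]
  have : ((homOfLE le_top).op ≫ (homOfLE h).op :
    Opposite.op (⊤ : (Spec (X.presheaf.stalk x)).Opens) ⟶ _) = 𝟙 _ := Subsingleton.elim _ _
  erw [this]
  simp

variable {E : Type u} [Field E] {X : Scheme.{u}} [X.Over (Spec (.of E))] [IsIntegral X] {l : ℕ}

/-- The spectrum of the local ring `Â` maps into any open set containing the image of its closed
point. So `s` has an image in `Â` that agrees in `Q(Â)` with its image from `K`, and `Â ∩ K = A`. -/
lemma FormalPrimeDivisor.algebraMap_mem_ring (φ : FormalPrimeDivisor E X l) {V : X.Opens}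
    [Nonempty V] (hV : φ.center ∈ V) (s : Γ(X, V)) :
    algebraMap Γ(X, V) X.functionField s ∈ φ.valuationRing.ring := by
  have h : ⊤ ≤ φ.hom ⁻¹ᵁ V := (Scheme.preimage_eq_top_of_closedPoint_mem φ.hom hV).ge
  have hη : genericPoint X ∈ V :=
    ((genericPoint_spec X).mem_open_set_iff V.isOpen).mpr (by simpa using ‹Nonempty V›)
  have h' : ⊤ ≤ X.fromSpecStalk (genericPoint X) ⁻¹ᵁ V := fun z _ =>
    (Scheme.range_fromSpecStalk.le (Set.mem_range_self z) : _ ⤳ _).mem_open V.isOpen hη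
  have h1 := comp_appLE_ΓSpecIso_hom φ.hom (CommRingCat.ofHom
        (algebraMap φ.valuationRing.Completion φ.valuationRing.CompletionField)) h
  have h2 := comp_appLE_ΓSpecIso_hom (X.fromSpecStalk (genericPoint X)) (CommRingCat.ofHom
        (algebraMap X.functionField φ.valuationRing.CompletionField)) h'
  rw [fromSpecStalk_appLE_ΓSpecIso_hom hη] at h2
  simp only [φ.generic_comp_hom] at h1
  have h3 := ConcreteCategory.congr_hom (h1.symm.trans h2) s
  exact φ.valuationRing.mem_ring_of_algebraMap_eq h3

lemma regularForms_subset_adjointForms (m : ℕ) (U : X.Opens) :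
    regularForms E X l m U ⊆ adjointForms E X l m U := by
  intro η hη φ hφ
  obtain ⟨V, _, hxV, -, θ, rfl⟩ := hη _ hφ
  let : Algebra Γ(X, V) φ.valuationRing.ring :=
    ((algebraMap Γ(X, V) X.functionField).codRestrict φ.valuationRing.ring.toSubring
      (φ.algebraMap_mem_ring hxV)).toAlgebra
  have : IsScalarTower Γ(X, V) φ.valuationRing.ring X.functionField := .of_algebraMap_eq' rfl
  have : IsScalarTower E Γ(X, V) φ.valuationRing.ring := .of_algebraMap_eq fun e =>
    Subtype.ext (IsScalarTower.algebraMap_apply E Γ(X, V) X.functionField e)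
  exact φ.valuationRing.pluriMap_map_mem_range Γ(X, V) m θ

end Scheme

/-- Both bases map to the same basis over `Q(Â)`. Comparing coefficients of its wedge power puts `f`
in `Â ∩ K = A`. -/
lemma DivisorialValuationRing.mem_ring_of_pluriMap_mem_range {E K : Type u} [Field E] [Field K]
    [Algebra E K] {l : ℕ} (A : DivisorialValuationRing E K l) {x : Fin l → A.ring}
    {b : Module.Basis (Fin l) K Ω[K⁄E]} {b' : Module.Basis (Fin l) A.ring Ω[A.ring⁄E]}
    (hb : ∀ i, b i = KaehlerDifferential.D E K (algebraMap A.ring K (x i)))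
    (hb' : ∀ i, b' i = KaehlerDifferential.D E A.ring (x i)) {m : ℕ} {f : K}
    (hf : pluriMap A.CompletionField A.ratDifferentialMap l m (f • wedgePow K m b) ∈
      LinearMap.range (pluriMap A.CompletionField A.differentialsToRat l m)) :
    f ∈ A.ring := by
  obtain ⟨ω, hω⟩ := hf
  obtain ⟨g, rfl⟩ := exists_eq_smul_wedgePow (b'.baseChange A.Completion) ω
  have h1 : A.ratDifferentialMap ∘ b = b'.baseChange A.CompletionField := by
    ext i
    rw [Function.comp_apply, hb, ratDifferentialMap_D_algebraMap, Module.Basis.baseChange_apply,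
      hb']
  have h2 : A.differentialsToRat ∘ (b'.baseChange A.Completion) =
      b'.baseChange A.CompletionField := by
    ext i
    rw [Function.comp_apply, Module.Basis.baseChange_apply, differentialsToRat_tmul, map_one,
      Module.Basis.baseChange_apply]
  rw [pluriMap_smul_wedgePow, pluriMap_smul_wedgePow, h1, h2] at hω
  exact A.mem_ring_of_algebraMap_eq
    (smul_wedgePow_injective (b'.baseChange A.CompletionField) m hω)

/-! ### Spreading out from `p`, and divisors centered near `p`. -/

section Scheme

lemma exists_section_family {X : Scheme.{u}} {p : X} {ι : Type*} [Finite ι]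
    (s : ι → X.presheaf.stalk p) :
    ∃ (V : X.Opens) (hp : p ∈ V) (t : ι → Γ(X, V)), ∀ i, X.presheaf.germ V p hp (t i) = s i := by
  choose U hU t ht using fun i => X.presheaf.exists_germ_eq (s i)
  let V : X.Opens := ⟨⋂ i, U i, isOpen_iInter_of_finite fun i => (U i).isOpen⟩
  have hV : ∀ i, V ≤ U i := fun i => Set.iInter_subset (fun i => (U i : Set X)) i
  refine ⟨V, Set.mem_iInter.mpr hU, fun i => X.presheaf.map (homOfLE (hV i)).op (t i), fun i => ?_⟩
  rw [X.presheaf.germ_res_apply, ht]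

variable {E : Type u} [Field E] {X : Scheme.{u}} [X.Over (Spec (.of E))] [IsIntegral X] {l : ℕ}

lemma exists_mem_regularForms {p : X}
    {b : Module.Basis (Fin l) X.functionField Ω[X.functionField⁄E]}
    {x : Fin l → X.presheaf.stalk p}
    (hb : ∀ i, b i = KaehlerDifferential.D E _ (algebraMap _ X.functionField (x i)))
    (r : X.presheaf.stalk p) (m : ℕ) :
    ∃ V : X.Opens, p ∈ V ∧
      algebraMap _ X.functionField r • wedgePow X.functionField m b ∈ regularForms E X l m V := by
  -- The coefficient `r` (index `none`) and all the `x i` are extended to one common neighbourhood.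
  obtain ⟨V, hp, t, ht⟩ := exists_section_family fun i : Option (Fin l) => i.elim r x
  have : Nonempty V := ⟨⟨p, hp⟩⟩
  refine ⟨V, hp, fun y hy => ⟨V, this, hy, le_rfl,
    t none • wedgePow Γ(X, V) m fun i => KaehlerDifferential.D E Γ(X, V) (t (some i)), ?_⟩⟩
  have h : ∀ i, algebraMap Γ(X, V) X.functionField (t i) =
      algebraMap _ X.functionField (i.elim r x : X.presheaf.stalk p) := fun i => by
    rw [← ht, Scheme.algebraMap_germ_eq_germToFunctionField]
    rfl
  rw [sectionToRat, pluriMap_smul_wedgePow, h]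
  congr 2
  ext i
  rw [Function.comp_apply, KaehlerDifferential.map_D, h, hb]
  rfl

/-- The morphism is `Spec Â → Spec A → Spec 𝒪_{X,p} → X`. The last map hits only generizations of
`p`, so the center lies in every open neighbourhood of `p`. -/
lemma exists_formalPrimeDivisor {p : X} (A : DivisorialValuationRing E X.functionField l)
    (hA : ∀ r : X.presheaf.stalk p, algebraMap _ X.functionField r ∈ A.ring) :
    ∃ φ : FormalPrimeDivisor E X l, φ.valuationRing = A ∧ φ.center ⤳ p := by
  let g : X.presheaf.stalk p →+* A.ring :=
    (algebraMap _ X.functionField).codRestrict A.ring.toSubring hA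
  refine ⟨⟨A, Spec.map (CommRingCat.ofHom ((algebraMap A.ring A.Completion).comp g)) ≫
    X.fromSpecStalk p, ?_⟩, rfl, Scheme.range_fromSpecStalk.le (Set.mem_range_self _)⟩
  rw [← Scheme.SpecMap_stalkSpecializes_fromSpecStalk
    ((genericPoint_spec X).specializes (Set.mem_univ p)), ← Spec.map_comp_assoc,
    ← Spec.map_comp_assoc]
  congr 2
  ext r
  change algebraMap A.Completion A.CompletionField (algebraMap A.ring A.Completion (g r)) =
    algebraMap X.functionField A.CompletionField (algebraMap A.ring X.functionField (g r))
  rw [← IsScalarTower.algebraMap_apply, ← IsScalarTower.algebraMap_apply]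

end Scheme

end AdjointForms

end

theorem mainTheorem6 {E : Type u} [Field E] [CharZero E]
    (X : Scheme.{u}) [X.Over (Spec (.of E))] [IsIntegral X]
    [IsSeparated (X ↘ Spec (.of E))] [LocallyOfFiniteType (X ↘ Spec (.of E))]
    [QuasiCompact (X ↘ Spec (.of E))]
    (l : ℕ) (hl : topologicalKrullDim X = l) (m : ℕ)
    (p : X) (hp : IsRegularLocalRing (X.presheaf.stalk p)) :
    AdjointForms.stalk (AdjointForms.regularForms E X l m) p =
      AdjointForms.stalk (AdjointForms.adjointForms E X l m) p := by
  apply Set.Subset.antisymm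
  · rintro η ⟨U, hpU, hη⟩
    exact ⟨U, hpU, AdjointForms.regularForms_subset_adjointForms m U hη⟩
  · rintro η ⟨U, hpU, hη⟩
    obtain ⟨_, _, _⟩ := AdjointForms.exists_algebra_stalk (E := E) p
    obtain ⟨x, ⟨b, hb⟩, hx⟩ := AdjointForms.exists_basis_and_divisorialValuationRing (E := E)
      (K := X.functionField) hp (AdjointForms.trdeg_functionField (E := E) hl)
    obtain ⟨f, rfl⟩ := AdjointForms.exists_eq_smul_wedgePow b η
    by_cases hf : f ∈ (algebraMap (X.presheaf.stalk p) X.functionField).range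
    · obtain ⟨r, rfl⟩ := hf
      exact AdjointForms.exists_mem_regularForms hb r m
    · obtain ⟨A, hA, hfA, b', hb'⟩ := hx f hf
      obtain ⟨φ, rfl, hφ⟩ := AdjointForms.exists_formalPrimeDivisor A hA
      exact absurd (φ.valuationRing.mem_ring_of_pluriMap_mem_range
        (x := fun i => ⟨_, hA (x i)⟩) hb hb' (hη φ (hφ.mem_open U.isOpen hpU))) hfA
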